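/- \textbf{Theorem (product rule for enriched monomials).} Let $\mathbf{k}$ be a commutative ring, and work in the ring $\mathbf{k}[[x_1,x_2,x_3,\ldots]]$ of formal power series in countably many commuting variables. A \emph{composition} is a finite (possibly empty) sequence $\alpha=(\alpha_1,\ldots,\alpha_p)$ of positive integers; we write $\ell(\alpha)=p$ and $|\alpha|=\alpha_1+\cdots+\alpha_p$ and $\operatorname{Des}(\alpha)=\{\alpha_1+\cdots+\alpha_k \mid 1\le k\le p-1\}$. Set $$M_\alpha=\sum_{i_1<\cdots<i_p}x_{i_1}^{\alpha_1}\cdots x_{i_p}^{\alpha_p},\qquad \eta_\alpha=\sum_{\substack{\beta \text{ composition},\ |\beta|=|\alpha|,\\ \operatorname{Des}(\beta)\subseteq\operatorname{Des}(\alpha)}}2^{\ell(\beta)}M_\beta ,$$ where the indices $i_1<\cdots<i_p$ are positive integers. For a composition $\gamma=(\gamma_1,\ldots,\gamma_r)$ and $2\le i\le r-1$, let $$\gamma^{\downarrow\downarrow i}=(\gamma_1,\ldots,\gamma_{i-2},\,\gamma_{i-1}+\gamma_i+\gamma_{i+1},\,\gamma_{i+2},\ldots,\gamma_r).$$ For a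 set $I=\{i_1<i_2<\cdots<i_k\}\subseteq\{2,\ldots,r-1\}$ containing no two consecutive integers, let $\gamma^{\downarrow\downarrow I}=\bigl(\cdots\bigl(\gamma^{\downarrow\downarrow i_k}\bigr)^{\downarrow\downarrow i_{k-1}}\cdots\bigr)^{\downarrow\downarrow i_1}$, with $\gamma^{\downarrow\downarrow\varnothing}=\gamma$. Let $\alpha=(\alpha_1,\ldots,\alpha_n)$ and $\beta=(\beta_1,\ldots,\beta_m)$ be two compositions. For each composition $\gamma$ with $n+m$ entries obtained by shuffling the entries of $\alpha$ and $\beta$ (written $\gamma\in\alpha \mathbin{\sqcup\!\sqcup} \beta$), let $S_\beta(\gamma)\subseteq\{1,\ldots,n+m\}$ be the set of the positions of the entries of $\beta$ in $\gamma$, and let $S_\beta(\gamma)-1=\{i-1\mid i\in S_\beta(\gamma)\}$. Then $$\eta_\alpha\,\eta_\beta=\sum_{\gamma\in\alpha \mathbin{\sqcup\!\sqcup} \beta}\ \ \sum_{I\subseteq\left(S_\beta(\gamma)\setminus(S_\beta(\gamma)-1)\right)\setminus\{1,\,n+m\}}(-1)^{|I|}\,\eta_{\gamma^{\downarrow\downarrow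 I}} .$$ Here the outer sum ranges not over compositions $\gamma$ but over the $\binom{n+m}{n}$ ways to shuffle $\alpha$ with $\beta$, so that the same $\gamma$ can appear in several addends. -/

import Mathlib

noncomputable section

namespace EnrichedMonomial

/-- The descent set `{c₁, c₁ + c₂, …, c₁ + ⋯ + c_{p-1}}` of a composition `c = (c₁, …, c_p)`. -/
def des {N : ℕ} (c : Composition N) : Finset ℕ :=
  (Finset.Ico 1 c.length).image c.sizeUpTo

/-- The monomial `x_{i₁}^{c₁} ⋯ x_{i_p}^{c_p}` as a power series in the variables
`x₁, x₂, x₃, …` (indexed by the positive integers). -/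
def monom (R : Type*) [CommRing R] {N : ℕ} (c : Composition N) (i : Fin c.length → ℕ+) :
    MvPowerSeries ℕ+ R :=
  ∏ j, MvPowerSeries.X (i j) ^ c.blocksFun j

/-- Every coefficient of `∑_{i} monom R c i`, over any family of index sequences `i`, is a finite
sum, so that `finsum` below never takes its default value. -/
theorem monom_finite_support (R : Type*) [CommRing R] {N : ℕ} (c : Composition N)
    (d : ℕ+ →₀ ℕ) :
    {i : Fin c.length → ℕ+ | MvPowerSeries.coeff d (monom R c i) ≠ 0}.Finite := by
  classical
  refine (Set.Finite.pi' (fun _ : Fin c.length => d.support.finite_toSet)).subset ?_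
  intro i hi j
  have h : monom R c i
      = MvPowerSeries.monomial (∑ j, Finsupp.single (i j) (c.blocksFun j)) (1 : R) := by
    have := MvPowerSeries.prod_monomial (R := R)
      (fun j => Finsupp.single (i j) (c.blocksFun j)) (fun _ => (1 : R)) Finset.univ
    simpa [monom, MvPowerSeries.X_pow_eq] using this
  have hd : d = ∑ j, Finsupp.single (i j) (c.blocksFun j) := by
    by_contra hne
    apply hi
    rw [h, MvPowerSeries.coeff_monomial, if_neg hne]
  rw [Finset.mem_coe, Finsupp.mem_support_iff, hd, Finsupp.finsetSum_apply]
  have h1 : 0 < c.blocksFun j := c.one_le_blocksFun j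
  have h2 := Finset.single_le_sum
    (f := fun k => (Finsupp.single (i k) (c.blocksFun k) : ℕ+ →₀ ℕ) (i j))
    (fun _ _ => Nat.zero_le _) (Finset.mem_univ j)
  simp only [Finsupp.single_eq_same] at h2
  omega

/-- The monomial quasisymmetric function
`M_c = ∑_{i₁ < ⋯ < i_p} x_{i₁}^{c₁} ⋯ x_{i_p}^{c_p}`, the infinite sum of power series being
formed coefficient by coefficient. -/
def M (R : Type*) [CommRing R] {N : ℕ} (c : Composition N) : MvPowerSeries ℕ+ R :=
  fun d => ∑ᶠ i : {i : Fin c.length → ℕ+ // StrictMono i},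
    MvPowerSeries.coeff d (monom R c i.1)

/-- The enriched monomial function
`η_c = ∑_{Des b ⊆ Des c} 2^{ℓ(b)} M_b`, where `b` runs over the compositions of the size of `c`. -/
def eta (R : Type*) [CommRing R] {N : ℕ} (c : Composition N) : MvPowerSeries ℕ+ R :=
  ∑ b : Composition N with des b ⊆ des c, (2 : R) ^ b.length • M R b

/-- The ways to shuffle a sequence of `n` entries with a sequence of `m` entries: a bijective
assignment of positions in the resulting sequence of `n + m` entries which preserves the order of
the entries within either sequence. -/
def Shuffle (n m : ℕ) : Type :=
  {e : Fin n ⊕ Fin m ≃ Fin (n + m) //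
    StrictMono (fun i => e (Sum.inl i)) ∧ StrictMono (fun j => e (Sum.inr j))}

instance (n m : ℕ) : Fintype (Shuffle n m) := by
  classical
  exact inferInstanceAs (Fintype {e : Fin n ⊕ Fin m ≃ Fin (n + m) //
    StrictMono (fun i => e (Sum.inl i)) ∧ StrictMono (fun j => e (Sum.inr j))})

/-- The composition with `n + m` entries obtained by shuffling the entries of `a` and `b`. -/
def Shuffle.comp {A B : ℕ} {a : Composition A} {b : Composition B}
    (s : Shuffle a.length b.length) : Composition (A + B) where
  blocks := List.ofFn fun k => Sum.elim a.blocksFun b.blocksFun (s.1.symm k)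
  blocks_pos := by
    intro x hx
    obtain ⟨k, rfl⟩ := (List.mem_ofFn' _ _).1 hx
    dsimp only
    rcases s.1.symm k with i | j
    · exact a.one_le_blocksFun i
    · exact b.one_le_blocksFun j
  blocks_sum := by
    rw [List.sum_ofFn, Equiv.sum_comp s.1.symm (Sum.elim a.blocksFun b.blocksFun),
      Fintype.sum_sum_type]
    simp [Composition.sum_blocksFun]

/-- The set of the positions (counted from `1`) of the entries of the second sequence. -/
def Shuffle.posSnd {n m : ℕ} (s : Shuffle n m) : Finset ℕ :=
  Finset.univ.image fun j : Fin m => (s.1 (Sum.inr j) : ℕ) + 1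

/-- For `2 ≤ i ≤ n - 1`, where `c = (c₁, …, c_n)`, this is the composition
`(c₁, …, c_{i-2}, c_{i-1} + c_i + c_{i+1}, c_{i+2}, …, c_n)`
with `n - 2` entries. For all other `i`, it is `c` by convention. -/
def mergeAt {N : ℕ} (c : Composition N) (i : ℕ) : Composition N :=
  if h : 2 ≤ i ∧ i < c.length then
    have hi : i < c.blocks.length := h.2
    { blocks := c.blocks.take (i - 2) ++
        (c.blocks[i - 2] + c.blocks[i - 1] + c.blocks[i]) :: c.blocks.drop (i + 1)
      blocks_pos := by
        intro x hx
        rcases List.mem_append.1 hx with hx | hx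
        · exact c.blocks_pos (List.mem_of_mem_take hx)
        · rcases List.mem_cons.1 hx with rfl | hx
          · have := c.blocks_pos (List.getElem_mem hi)
            omega
          · exact c.blocks_pos (List.mem_of_mem_drop hx)
      blocks_sum := by
        have e : c.blocks = c.blocks.take (i - 2) ++
            c.blocks[i - 2] :: c.blocks[i - 1] :: c.blocks[i] :: c.blocks.drop (i + 1) := by
          conv_lhs => rw [← List.take_append_drop (i - 2) c.blocks]
          congr 1
          rw [List.drop_eq_getElem_cons (by omega), List.drop_eq_getElem_cons (by omega),
            List.drop_eq_getElem_cons (by omega)]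
          have h1 : i - 2 + 1 = i - 1 := by omega
          have h2 : i - 1 + 1 = i := by omega
          simp only [h1, h2]
        have hs := c.blocks_sum
        rw [e] at hs
        simp only [List.sum_append, List.sum_cons] at hs ⊢
        omega }
  else c

/-- For `I = {i₁ < i₂ < ⋯ < i_k}`, merge at `i_k` first, then at `i_{k-1}`, …, and last at `i₁`. -/
def mergeSet {N : ℕ} (c : Composition N) (I : Finset ℕ) : Composition N :=
  (I.sort (· ≤ ·)).foldr (fun i c' => mergeAt c' i) c

end EnrichedMonomial

end

/-! In variables `v₁ < ⋯ < v_k`, the function `η_w` is the sum, over all ways to cut `w` into `k`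
consecutive, possibly empty pieces, of a product of one-variable factors: an empty piece gives `1`,
and a nonempty piece of size `s` gives `2 x^s`. Indeed, the nonempty pieces describe a coarsening of
`w`, and each supplies one factor `2`. So `η`, as a function of the word, is a convolution of the
functions `oneVar`; this is `genFn`, and `coeff_eta_eq_coeff_genFn` makes the comparison one
coefficient at a time.

The product rule says that this function is multiplicative for shuffles with signed merges
(`IsMultiplicative`). The property survives convolution. Cutting a shuffle amounts to cutting both
words and shuffling the pieces (`shuffleSum_conv`). Merges also respect cuts: whether a letter may
be merged depends only on it and its two neighbours, so the merges available in the two pieces are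
those of the whole word that do not straddle the cut (`mergeSum_conv`).

It remains to treat one variable (`isMultiplicative_oneVar`). Merging preserves the sum of the
letters, so only `∑ (-1)^|I|` over sets of mergeable positions matters, and this vanishes unless no
letter is mergeable. For nonempty words exactly two shuffles survive, one for each choice of first
letter, and `2 * 2 = 2 + 2`. -/

namespace EnrichedMonomial

/-! ### Shuffles, merges and convolution of functions on words -/

section Core

variable {S : Type*} [CommRing S]

/-- Convolution of two functions on words, with respect to deconcatenation. -/
def conv {α : Type*} (f g : List α → S) (w : List α) : S :=
  ∑ i ∈ Finset.range (w.length + 1), f (w.take i) * g (w.drop i)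

theorem conv_nil {α : Type*} (f g : List α → S) : conv f g [] = f [] * g [] := by
  simp [conv]

theorem conv_cons {α : Type*} (f g : List α → S) (x : α) (w : List α) :
    conv f g (x :: w) = f [] * g (x :: w) + conv (fun l => f (x :: l)) g w := by
  rw [conv, List.length_cons, Finset.sum_range_succ' _ (w.length + 1), add_comm]
  simp [conv]

theorem conv_sub_left {α : Type*} (f f' g : List α → S) (w : List α) :
    conv (fun l => f l - f' l) g w = conv f g w - conv f' g w := by
  simp [conv, sub_mul]

/-- All shuffles of two words, as words with marked letters. -/
def shuffles {α β : Type*} : List α → List β → List (List (α ⊕ β))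
  | [], b => [b.map Sum.inr]
  | a :: as, [] => [(a :: as).map Sum.inl]
  | a :: as, b :: bs =>
    (shuffles as (b :: bs)).map (Sum.inl a :: ·) ++ (shuffles (a :: as) bs).map (Sum.inr b :: ·)

/-- The sum of a function over all shuffles of two words. -/
def shuffleSum {α β : Type*} (F : List (α ⊕ β) → S) (a : List α) (b : List β) : S :=
  ((shuffles a b).map F).sum

theorem shuffleSum_nil_left {α β : Type*} (F : List (α ⊕ β) → S) (b : List β) :
    shuffleSum F [] b = F (b.map Sum.inr) := by
  simp [shuffleSum, shuffles]

theorem shuffleSum_nil_right {α β : Type*} (F : List (α ⊕ β) → S) (a : List α) :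
    shuffleSum F a [] = F (a.map Sum.inl) := by
  cases a <;> simp [shuffleSum, shuffles]

theorem shuffleSum_cons {α β : Type*} (F : List (α ⊕ β) → S) (x : α) (a : List α) (y : β)
    (b : List β) :
    shuffleSum F (x :: a) (y :: b) = shuffleSum (fun u => F (Sum.inl x :: u)) a (y :: b) +
      shuffleSum (fun u => F (Sum.inr y :: u)) (x :: a) b := by
  simp [shuffleSum, shuffles, Function.comp_def]

theorem shuffleSum_add {α β : Type*} (F G : List (α ⊕ β) → S) (a : List α) (b : List β) :
    shuffleSum (fun u => F u + G u) a b = shuffleSum F a b + shuffleSum G a b := by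
  simp [shuffleSum, List.sum_map_add]

theorem shuffleSum_const_mul {α β : Type*} (c : S) (F : List (α ⊕ β) → S) (a : List α)
    (b : List β) :
    shuffleSum (fun u => c * F u) a b = c * shuffleSum F a b := by
  simp [shuffleSum, List.sum_map_mul_left]

/-- Deconcatenation is compatible with shuffling. -/
theorem shuffleSum_conv {α β : Type*} (F G : List (α ⊕ β) → S) (a : List α) (b : List β) :
    shuffleSum (conv F G) a b =
      ∑ i ∈ Finset.range (a.length + 1), ∑ j ∈ Finset.range (b.length + 1),
        shuffleSum F (a.take i) (b.take j) * shuffleSum G (a.drop i) (b.drop j) := by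
  induction a generalizing F b with
  | nil => simp [shuffleSum_nil_left, conv, List.map_take, List.map_drop]
  | cons x a iha =>
    induction b generalizing F with
    | nil =>
      simp only [shuffleSum_nil_right, conv, List.length_map, List.map_take, List.map_drop,
        List.length_nil, zero_add, Finset.sum_range_one, List.take_nil, List.drop_nil]
    | cons y b ihb =>
      rw [shuffleSum_cons]
      simp only [conv_cons, shuffleSum_add, shuffleSum_const_mul]
      rw [iha, ihb]
      simp only [List.length_cons]
      have h0 := shuffleSum_cons G x a y b
      -- The terms with `i = 0` or `j = 0` are split off: there a prefix is empty, and the recursion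
      -- for shuffles of two nonempty words does not apply to it.
      rw [Finset.sum_range_succ' _ (a.length + 1), Finset.sum_range_succ' _ (a.length + 1)]
      simp only [Finset.sum_range_succ' _ (b.length + 1), List.take_zero, List.drop_zero,
        List.take_succ_cons, List.drop_succ_cons, shuffleSum_cons, shuffleSum_nil_left,
        shuffleSum_nil_right, List.map_cons, List.map_nil, add_mul, Finset.sum_add_distrib]
      ring

/-- The word obtained from a nonempty word by adding a number to its first letter. -/
def addHead (x : ℕ) : List ℕ → List ℕ
  | [] => [x]
  | c :: l => (x + c) :: l

/-- The signed sum of the values of `f` on all words obtained from a marked word by merging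
letters with their two neighbours, where the letters allowed to be merged are the ones which
come from the second word, are not the first letter, and are followed by a letter from the first
word. -/
def mergeSum (f : List ℕ → S) : List (ℕ ⊕ ℕ) → S
  | [] => f []
  | x :: Sum.inr y :: Sum.inl z :: r =>
    mergeSum (fun l => f (x.elim id id :: l)) (Sum.inr y :: Sum.inl z :: r) -
      mergeSum (fun l => f (addHead (x.elim id id + y) l)) (Sum.inl z :: r)
  | x :: r => mergeSum (fun l => f (x.elim id id :: l)) r

theorem mergeSum_nil (f : List ℕ → S) : mergeSum f [] = f [] := by
  simp [mergeSum]

theorem mergeSum_inr_inl (f : List ℕ → S) (x : ℕ ⊕ ℕ) (y z : ℕ) (r : List (ℕ ⊕ ℕ)) :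
    mergeSum f (x :: Sum.inr y :: Sum.inl z :: r) =
      mergeSum (fun l => f (x.elim id id :: l)) (Sum.inr y :: Sum.inl z :: r) -
        mergeSum (fun l => f (addHead (x.elim id id + y) l)) (Sum.inl z :: r) := by
  rw [mergeSum]

theorem mergeSum_cons (f : List ℕ → S) (x : ℕ ⊕ ℕ) (r : List (ℕ ⊕ ℕ))
    (h : ∀ y z r', r ≠ Sum.inr y :: Sum.inl z :: r') :
    mergeSum f (x :: r) = mergeSum (fun l => f (x.elim id id :: l)) r := by
  rw [mergeSum]
  intro y z r' e
  exact h y z r' e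

/-- The cases follow the branches of `mergeSum`. A merge consumes two letters, so the second case
needs the hypothesis for two different tails. -/
theorem mergeSum_induction {P : List (ℕ ⊕ ℕ) → Prop} (nil : P [])
    (inr_inl : ∀ x y z r, P (Sum.inr y :: Sum.inl z :: r) → P (Sum.inl z :: r) →
      P (x :: Sum.inr y :: Sum.inl z :: r))
    (cons : ∀ x r, (∀ y z r', r ≠ Sum.inr y :: Sum.inl z :: r') → P r → P (x :: r))
    (u : List (ℕ ⊕ ℕ)) : P u := by
  induction h : u.length using Nat.strong_induction_on generalizing u with
  | _ n ih =>
    subst h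
    rcases u with _ | ⟨x, r⟩
    · exact nil
    · by_cases h : ∃ y z r', r = Sum.inr y :: Sum.inl z :: r'
      · obtain ⟨y, z, r', rfl⟩ := h
        exact inr_inl x y z r' (ih _ (by simp) _ rfl) (ih _ (by simp) _ rfl)
      · push Not at h
        exact cons x r h (ih _ (by simp) _ rfl)

theorem mergeSum_add (f g : List ℕ → S) (u : List (ℕ ⊕ ℕ)) :
    mergeSum (fun w => f w + g w) u = mergeSum f u + mergeSum g u := by
  induction u using mergeSum_induction generalizing f g with
  | nil => simp [mergeSum_nil]
  | inr_inl x y z r h1 h2 => simp only [mergeSum_inr_inl, h1, h2]; ring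
  | cons x r h ih => simp only [mergeSum_cons _ _ _ h, ih]

theorem mergeSum_const_mul (c : S) (f : List ℕ → S) (u : List (ℕ ⊕ ℕ)) :
    mergeSum (fun w => c * f w) u = c * mergeSum f u := by
  induction u using mergeSum_induction generalizing f with
  | nil => simp [mergeSum_nil]
  | inr_inl x y z r h1 h2 => simp only [mergeSum_inr_inl, h1, h2]; ring
  | cons x r h ih => simp only [mergeSum_cons _ _ _ h, ih]

/-- Merging never empties a nonempty word, so the values of `f` and `g` at `[]` are irrelevant. -/
theorem mergeSum_congr {f g : List ℕ → S} (x : ℕ ⊕ ℕ) (r : List (ℕ ⊕ ℕ))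
    (h : ∀ y l, f (y :: l) = g (y :: l)) : mergeSum f (x :: r) = mergeSum g (x :: r) := by
  have aux : ∀ k, (fun l => f (addHead k l)) = fun l => g (addHead k l) := by
    intro k
    funext l
    cases l <;> simp [addHead, h]
  by_cases hr : ∃ y z r', r = Sum.inr y :: Sum.inl z :: r'
  · obtain ⟨y, z, r', rfl⟩ := hr
    simp only [mergeSum_inr_inl, h, aux]
  · push Not at hr
    simp only [mergeSum_cons _ _ _ hr, h]

/-- Merging is compatible with deconcatenation. -/
theorem mergeSum_conv (f g : List ℕ → S) (u : List (ℕ ⊕ ℕ)) :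
    mergeSum (conv f g) u = conv (mergeSum f) (mergeSum g) u := by
  induction u using mergeSum_induction generalizing f with
  | nil => simp [mergeSum_nil, conv_nil]
  | inr_inl x y z r h1 h2 =>
    have h2' := h2 (fun l => f (addHead (x.elim id id + y) l))
    -- Adding to the first letter almost commutes with `conv`. On the right, the cut before the
    -- first letter separates the merged sum from the letter it is to be added to; this spurious
    -- term is removed and replaced by the cut in front of the whole merged letter.
    have e : mergeSum (fun l => conv f g (addHead (x.elim id id + y) l)) (Sum.inl z :: r) =
        mergeSum (conv (fun l => f (addHead (x.elim id id + y) l)) g) (Sum.inl z :: r)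
        - f [(x.elim id id + y)] * mergeSum g (Sum.inl z :: r)
        + f [] * mergeSum (fun l => g (addHead (x.elim id id + y) l)) (Sum.inl z :: r) := by
      rw [sub_eq_add_neg, ← neg_mul, ← mergeSum_const_mul, ← mergeSum_const_mul, ← mergeSum_add,
        ← mergeSum_add]
      apply mergeSum_congr
      intro c l
      simp only [addHead, conv_cons]
      ring
    rw [mergeSum_inr_inl, e, h2']
    simp only [conv_cons, mergeSum_add, mergeSum_const_mul, mergeSum_inr_inl, h1, conv_sub_left]
    simp [mergeSum, addHead]
    ring
  | cons x r h ih =>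
    rw [mergeSum_cons _ _ _ h]
    simp only [conv_cons, mergeSum_add, mergeSum_const_mul, mergeSum_nil, ih]
    rw [mergeSum_cons _ _ _ h]
    congr 1
    refine Finset.sum_congr rfl fun i _ => ?_
    dsimp only
    -- A prefix of a tail that does not begin with an `inr`, `inl` pair does not begin with one
    -- either.
    rw [mergeSum_cons]
    intro y z r' e
    exact h y z (r' ++ r.drop i) (by rw [← List.cons_append, ← List.cons_append, ← e]; simp)

theorem shuffleSum_congr {α β : Type*} {F G : List (α ⊕ β) → S} (h : ∀ u, F u = G u) (a : List α)
    (b : List β) : shuffleSum F a b = shuffleSum G a b := by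
  rw [funext h]

/-- A function on words is multiplicative if the product of two of its values is its sum over all
shuffles with merges. -/
def IsMultiplicative (f : List ℕ → S) : Prop :=
  ∀ a b, f a * f b = shuffleSum (mergeSum f) a b

theorem IsMultiplicative.conv {f g : List ℕ → S} (hf : IsMultiplicative f)
    (hg : IsMultiplicative g) : IsMultiplicative (conv f g) := by
  intro a b
  rw [shuffleSum_congr (mergeSum_conv f g), shuffleSum_conv, EnrichedMonomial.conv,
    EnrichedMonomial.conv, Finset.sum_mul_sum]
  refine Finset.sum_congr rfl fun i _ => Finset.sum_congr rfl fun j _ => ?_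
  rw [← hf, ← hg]
  ring

/-! ### Multiplicativity in zero variables and in one variable -/

/-- The indicator function of the empty word. -/
def unitFn (w : List ℕ) : S := if w = [] then 1 else 0

theorem mergeSum_zero (u : List (ℕ ⊕ ℕ)) : mergeSum (fun _ => (0 : S)) u = 0 := by
  simpa using mergeSum_const_mul (0 : S) (fun _ => 0) u

theorem mergeSum_unitFn_cons (x : ℕ ⊕ ℕ) (u : List (ℕ ⊕ ℕ)) :
    mergeSum (unitFn : List ℕ → S) (x :: u) = 0 := by
  rw [← mergeSum_zero (x :: u)]
  exact mergeSum_congr _ _ fun y l => by simp [unitFn]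

theorem shuffleSum_zero {α β : Type*} (a : List α) (b : List β) :
    shuffleSum (fun _ => (0 : S)) a b = 0 := by
  simp [shuffleSum]

theorem isMultiplicative_unitFn : IsMultiplicative (unitFn : List ℕ → S) := by
  rintro (_ | ⟨x, a⟩) (_ | ⟨y, b⟩)
  · simp [shuffleSum_nil_left, mergeSum_nil, unitFn]
  · simp [shuffleSum_nil_left, mergeSum_unitFn_cons, unitFn]
  · simp [shuffleSum_nil_right, mergeSum_unitFn_cons, unitFn]
  · simp [shuffleSum_cons, mergeSum_unitFn_cons, unitFn, shuffleSum_zero]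

/-- Merging preserves the sum of the letters, so the power of `t` factors out and a signed count of
merges remains. -/
theorem mergeSum_mul_pow (c t : S) (u : List (ℕ ⊕ ℕ)) :
    mergeSum (fun w => c * t ^ w.sum) u =
      c * t ^ (u.map (Sum.elim id id)).sum * mergeSum (fun _ => 1) u := by
  induction u using mergeSum_induction generalizing c with
  | nil => simp [mergeSum_nil]
  | inr_inl x y z r h1 h2 =>
    have e : mergeSum (fun l => c * t ^ (addHead (x.elim id id + y) l).sum) (Sum.inl z :: r) =
        mergeSum (fun l => (c * t ^ (x.elim id id + y)) * t ^ l.sum) (Sum.inl z :: r) := by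
      apply mergeSum_congr
      intro y l
      simp only [addHead, List.sum_cons]
      ring
    simp only [mergeSum_inr_inl, e, List.sum_cons, pow_add t, ← mul_assoc, h1, h2, List.map_cons,
      Sum.elim_inl, Sum.elim_inr, id]
    ring
  | cons x r h ih =>
    simp only [mergeSum_cons _ _ _ h, List.sum_cons, pow_add t, ← mul_assoc, ih, List.map_cons]

/-- The indicator function of the marked words in which all letters of the first word precede
those of the second. -/
def sortedInd {α β : Type*} : List (α ⊕ β) → S
  | [] => 1
  | Sum.inl _ :: r => sortedInd r
  | Sum.inr _ :: r => if r.all Sum.isRight then 1 else 0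

/-- The alternating sum over subsets of the mergeable positions is `0` unless there are none, that
is, unless past the first letter no `inr` is followed by an `inl`. -/
theorem mergeSum_one_cons (x : ℕ ⊕ ℕ) (u : List (ℕ ⊕ ℕ)) :
    mergeSum (fun _ => (1 : S)) (x :: u) = sortedInd u := by
  induction u generalizing x with
  | nil => simp [mergeSum, sortedInd]
  | cons y r ih =>
    rcases y with y | y
    · rw [mergeSum_cons _ _ _ (by simp), ih, sortedInd]
    · rcases r with _ | ⟨z | z, r⟩
      · simp [mergeSum, sortedInd]
      -- Merging at `y` and not merging there leave equal signed counts, which cancel. The dummy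
      -- first letter `Sum.inl z` turns `ih` into a statement about `Sum.inl z :: r` itself.
      · have h := ih (Sum.inl z)
        rw [mergeSum_cons _ _ _ (by simp)] at h
        rw [mergeSum_inr_inl, ih, h]
        simp [sortedInd]
      · rw [mergeSum_cons _ _ _ (by simp), ih]
        rfl

theorem shuffleSum_all_isRight {α β : Type*} (x : α) (a : List α) (b : List β) :
    shuffleSum (fun r : List (α ⊕ β) => if r.all Sum.isRight then (1 : S) else 0) (x :: a) b =
      0 := by
  induction b with
  | nil => simp [shuffleSum_nil_right]
  | cons y b ih =>
    rw [shuffleSum_cons]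
    exact (congrArg₂ (· + ·) (shuffleSum_zero a (y :: b)) ih).trans (add_zero 0)

/-- Only the concatenation of `a` and `b` is sorted. -/
theorem shuffleSum_sortedInd {α β : Type*} (a : List α) (b : List β) :
    shuffleSum (sortedInd : List (α ⊕ β) → S) a b = 1 := by
  induction a with
  | nil => cases b <;> simp [sortedInd, shuffleSum_nil_left]
  | cons x a ih =>
    cases b with
    | nil => rw [shuffleSum_nil_right, List.map_cons, sortedInd, ← ih, shuffleSum_nil_right]
    | cons y b =>
      rw [shuffleSum_cons]
      simp only [sortedInd, ih, shuffleSum_all_isRight, add_zero]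

theorem sum_of_mem_shuffles (a b : List ℕ) (u : List (ℕ ⊕ ℕ)) (hu : u ∈ shuffles a b) :
    (u.map (Sum.elim id id)).sum = a.sum + b.sum := by
  fun_induction shuffles a b generalizing u with
  | case1 b => simp_all
  | case2 x a => simp_all
  | case3 x a y b ih1 ih2 =>
    simp only [List.mem_append, List.mem_map] at hu
    rcases hu with ⟨v, hv, rfl⟩ | ⟨v, hv, rfl⟩
    · simp [ih1 v hv, add_assoc]
    · simp [ih2 v hv, add_left_comm]

theorem mergeSum_map_inl (f : List ℕ → S) (a : List ℕ) : mergeSum f (a.map Sum.inl) = f a := by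
  induction a generalizing f with
  | nil => exact mergeSum_nil f
  | cons x a ih =>
    rw [List.map_cons, mergeSum_cons, ih]
    · rfl
    · cases a <;> simp

theorem mergeSum_map_inr (f : List ℕ → S) (a : List ℕ) : mergeSum f (a.map Sum.inr) = f a := by
  induction a generalizing f with
  | nil => exact mergeSum_nil f
  | cons x a ih =>
    rw [List.map_cons, mergeSum_cons, ih]
    · rfl
    · rcases a with _ | ⟨_, _ | _⟩ <;> simp

/-- The function which sends the empty word to `1` and each other word to `2 t ^ k`, where `k` is
the sum of its letters. -/
def oneVar (t : S) (w : List ℕ) : S := if w = [] then 1 else 2 * t ^ w.sum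

theorem isMultiplicative_oneVar (t : S) : IsMultiplicative (oneVar t) := by
  have key : ∀ x u, mergeSum (oneVar t) (x :: u) =
      2 * t ^ ((x :: u).map (Sum.elim id id)).sum * sortedInd u := by
    intro x u
    rw [mergeSum_congr (g := fun w => 2 * t ^ w.sum), mergeSum_mul_pow, mergeSum_one_cons]
    simp [oneVar]
  have aux : ∀ (k : ℕ) (a b : List ℕ),
      shuffleSum (fun u => 2 * t ^ (k + (u.map (Sum.elim id id)).sum) * sortedInd u) a b =
        2 * t ^ (k + (a.sum + b.sum)) := by
    intro k a b
    rw [← mul_one (2 * t ^ _), ← shuffleSum_sortedInd a b, ← shuffleSum_const_mul]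
    unfold shuffleSum
    congr 1
    exact List.map_congr_left fun u hu => by rw [sum_of_mem_shuffles a b u hu]
  rintro (_ | ⟨x, a⟩) (_ | ⟨y, b⟩)
  · simp [shuffleSum_nil_left, mergeSum_nil, oneVar]
  · rw [shuffleSum_nil_left, mergeSum_map_inr]
    simp [oneVar]
  · rw [shuffleSum_nil_right, mergeSum_map_inl]
    simp [oneVar]
  · rw [shuffleSum_cons]
    simp only [key, List.map_cons, List.sum_cons, aux, Sum.elim_inl, Sum.elim_inr, id]
    simp only [oneVar, List.sum_cons, reduceCtorEq, if_false]
    ring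

end Core

/-! ### Coefficients of the enriched monomial functions -/

section Coefficients

/-- A word `b` is coarser than `w` if it is the list of sums of consecutive segments of `w`. -/
def IsCoarser : List ℕ → List ℕ → Prop
  | [], w => w = []
  | x :: b, w => ∃ i, (w.take i).sum = x ∧ IsCoarser b (w.drop i)

/-- Turns the recursive notion into an inclusion of sets of partial sums, the form in which descent
sets are compared. -/
theorem isCoarser_iff {b w : List ℕ} (hw : ∀ x ∈ w, 0 < x) (h : b.sum = w.sum) :
    IsCoarser b w ↔ ∀ i, ∃ j, (w.take j).sum = (b.take i).sum := by
  induction b generalizing w with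
  | nil =>
    have hw0 : w = [] := by
      rcases w with _ | ⟨x, w⟩
      · rfl
      · have := hw x (by simp)
        simp only [List.sum_nil, List.sum_cons] at h
        omega
    subst hw0
    simp [IsCoarser]
  | cons x b ih =>
    have key : ∀ k, (w.take k).sum = x → b.sum = (w.drop k).sum := by
      intro k hk
      have := List.sum_take_add_sum_drop w k
      rw [List.sum_cons] at h
      omega
    have hpos : ∀ k, ∀ x ∈ w.drop k, 0 < x := fun k x hx => hw x (List.mem_of_mem_drop hx)
    constructor
    · rintro ⟨k, hk, hc⟩ i
      rcases i with _ | i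
      · exact ⟨0, by simp⟩
      · obtain ⟨j, hj⟩ := (ih (hpos k) (key k hk)).1 hc i
        exact ⟨k + j, by simp [List.take_add, hk, hj]⟩
    · intro H
      obtain ⟨k, hk⟩ := H 1
      simp only [List.take_succ_cons, List.take_zero, List.sum_cons, List.sum_nil, add_zero] at hk
      refine ⟨k, hk, (ih (hpos k) (key k hk)).2 fun i => ?_⟩
      obtain ⟨j, hj⟩ := H (i + 1)
      rw [List.take_succ_cons, List.sum_cons] at hj
      rcases le_total k j with hkj | hkj
      · obtain ⟨j, rfl⟩ := Nat.exists_eq_add_of_le hkj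
        refine ⟨j, ?_⟩
        rw [List.take_add, List.sum_append] at hj
        omega
      -- Here the first `j` letters of `w` sum to at most `x`, which forces the first `i` letters of
      -- `b` to sum to `0`.
      · refine ⟨0, ?_⟩
        obtain ⟨k, rfl⟩ := Nat.exists_eq_add_of_le hkj
        rw [List.take_add, List.sum_append] at hk
        simp only [List.take_zero, List.sum_nil]
        omega

/-- Descent sets omit the partial sums `0` and `N`, but these are common to all compositions of `N`.
-/
theorem des_subset_des_iff {N : ℕ} (b c : Composition N) :
    des b ⊆ des c ↔ IsCoarser b.blocks c.blocks := by
  rw [isCoarser_iff (fun _ => c.blocks_pos) (by rw [b.blocks_sum, c.blocks_sum])]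
  change _ ↔ ∀ i, ∃ j, c.sizeUpTo j = b.sizeUpTo i
  constructor
  · intro h i
    rcases Nat.eq_zero_or_pos i with rfl | hi
    · exact ⟨0, by simp⟩
    rcases lt_or_ge i b.length with hl | hl
    · have := h (Finset.mem_image_of_mem _ (Finset.mem_Ico.2 ⟨hi, hl⟩))
      obtain ⟨j, -, hj⟩ := Finset.mem_image.1 this
      exact ⟨j, hj⟩
    · exact ⟨c.length, by rw [c.sizeUpTo_length, b.sizeUpTo_ofLength_le i hl]⟩
  · intro h x hx
    obtain ⟨i, hi, rfl⟩ := Finset.mem_image.1 hx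
    rw [Finset.mem_Ico] at hi
    obtain ⟨j, hj⟩ := h i
    refine Finset.mem_image.2 ⟨j, Finset.mem_Ico.2 ⟨?_, ?_⟩, hj⟩
    · by_contra hj0
      obtain rfl : j = 0 := by omega
      have h1 := b.sizeUpTo_strict_mono (i := 0) (by omega)
      have h2 := b.monotone_sizeUpTo hi.1
      rw [c.sizeUpTo_zero] at hj
      simp only [zero_add] at h1
      omega
    · by_contra hjl
      rw [c.sizeUpTo_ofLength_le j (by omega)] at hj
      have h1 := b.sizeUpTo_strict_mono hi.2
      have h2 := b.sizeUpTo_le (i + 1)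
      omega

/-- The nonzero exponents of a monomial, in the order of the variables. -/
def exponents (d : ℕ+ →₀ ℕ) : List ℕ :=
  (d.support.sort (· ≤ ·)).map d

theorem coeff_monom (R : Type*) [CommRing R] {N : ℕ} (c : Composition N)
    (i : Fin c.length → ℕ+) (d : ℕ+ →₀ ℕ) :
    MvPowerSeries.coeff d (monom R c i) =
      if d = ∑ j, Finsupp.single (i j) (c.blocksFun j) then 1 else 0 := by
  classical
  have h := MvPowerSeries.prod_monomial (R := R)
    (fun j => Finsupp.single (i j) (c.blocksFun j)) (fun _ => (1 : R)) Finset.univ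
  have : monom R c i
      = MvPowerSeries.monomial (∑ j, Finsupp.single (i j) (c.blocksFun j)) (1 : R) := by
    simpa [monom, MvPowerSeries.X_pow_eq] using h
  rw [this, MvPowerSeries.coeff_monomial]

/-- Since all parts are positive, the support of the monomial is the set of indices used, so an
increasing index sequence can be recovered from the monomial. Hence at most one sequence contributes
to each coefficient of `M`. -/
theorem strictMono_eq_sum_single_iff {N : ℕ} (c : Composition N) (d : ℕ+ →₀ ℕ)
    (i : Fin c.length → ℕ+) (hi : StrictMono i) :
    d = ∑ j, Finsupp.single (i j) (c.blocksFun j) ↔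
      List.ofFn i = d.support.sort (· ≤ ·) ∧ c.blocks = exponents d := by
  classical
  have hval : ∀ k, (∑ j, Finsupp.single (i j) (c.blocksFun j) : ℕ+ →₀ ℕ) (i k) = c.blocksFun k := by
    intro k
    rw [Finsupp.finsetSum_apply, Finset.sum_eq_single k]
    · simp
    · intro j _ hj
      exact Finsupp.single_eq_of_ne (fun e => hj (hi.injective e).symm)
    · simp
  have hval' : ∀ v, (∀ k, i k ≠ v) → (∑ j, Finsupp.single (i j) (c.blocksFun j) : ℕ+ →₀ ℕ) v = 0 := by
    intro v hv
    rw [Finsupp.finsetSum_apply, Finset.sum_eq_zero]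
    intro j _
    exact Finsupp.single_eq_of_ne (hv j).symm
  have hmem : ∀ v, v ∈ List.ofFn i ↔ ∃ k, i k = v := by simp
  constructor
  · intro hd
    have h1 : List.ofFn i = d.support.sort (· ≤ ·) := by
      refine List.SortedLT.eq_of_mem_iff (List.sortedLT_ofFn_iff.2 hi) (Finset.sortedLT_sort _) ?_
      intro v
      rw [hmem, Finset.mem_sort, Finsupp.mem_support_iff]
      constructor
      · rintro ⟨k, rfl⟩
        rw [hd, hval]
        exact Nat.ne_of_gt (c.one_le_blocksFun k)
      · intro h
        by_contra! hv
        exact h (by rw [hd, hval' v hv])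
    refine ⟨h1, ?_⟩
    rw [exponents, ← h1, List.map_ofFn, ← c.ofFn_blocksFun]
    congr 1
    funext k
    rw [Function.comp_apply, hd, hval]
  · rintro ⟨h1, h2⟩
    rw [exponents, ← h1, List.map_ofFn, ← c.ofFn_blocksFun] at h2
    have h3 := List.ofFn_injective h2
    ext v
    by_cases hv : ∃ k, i k = v
    · obtain ⟨k, rfl⟩ := hv
      rw [hval, h3, Function.comp_apply]
    · push Not at hv
      rw [hval' v hv]
      by_contra h0
      rw [← ne_eq, ← Finsupp.mem_support_iff, ← Finset.mem_sort (· ≤ ·), ← h1, hmem] at h0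
      obtain ⟨k, hk⟩ := h0
      exact hv k hk

theorem coeff_M (R : Type*) [CommRing R] {N : ℕ} (c : Composition N) (d : ℕ+ →₀ ℕ) :
    MvPowerSeries.coeff d (M R c) = if c.blocks = exponents d then 1 else 0 := by
  classical
  have h0 : MvPowerSeries.coeff d (M R c) = ∑ᶠ i : {i : Fin c.length → ℕ+ // StrictMono i},
    MvPowerSeries.coeff d (monom R c i.1) := rfl
  have h1 : ∀ i : {i : Fin c.length → ℕ+ // StrictMono i},
      MvPowerSeries.coeff d (monom R c i.1) =
        if List.ofFn i.1 = d.support.sort (· ≤ ·) ∧ c.blocks = exponents d then 1 else 0 := by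
    intro i
    rw [coeff_monom]
    exact if_congr (strictMono_eq_sum_single_iff c d i.1 i.2) rfl rfl
  rw [h0, finsum_congr h1]
  split_ifs with h
  · have hl : d.support.card = c.length := by
      rw [Composition.length, h, exponents, List.length_map, Finset.length_sort]
    have he : List.ofFn (d.support.orderEmbOfFin hl) = d.support.sort (· ≤ ·) := by
      rw [← Finset.listMap_orderEmbOfFin_finRange d.support hl, List.ofFn_eq_map]
    rw [finsum_eq_single _ ⟨d.support.orderEmbOfFin hl, (d.support.orderEmbOfFin hl).strictMono⟩]
    · simp only [he, h, and_self, if_true]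
    · rintro ⟨i, hi⟩ hne
      rw [if_neg]
      rintro ⟨h3, -⟩
      exact hne (Subtype.ext (List.ofFn_injective (h3.trans he.symm)))
  · simp [h]

open Classical in
theorem coeff_eta (R : Type*) [CommRing R] {N : ℕ} (c : Composition N) (d : ℕ+ →₀ ℕ) :
    MvPowerSeries.coeff d (eta R c) =
      if IsCoarser (exponents d) c.blocks then 2 ^ (exponents d).length else 0 := by
  simp only [eta, map_sum, map_smul, coeff_M, des_subset_des_iff]
  have hsum : ∀ {b w : List ℕ}, IsCoarser b w → b.sum = w.sum := by
    intro b w h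
    induction b generalizing w with
    | nil =>
      obtain rfl : w = [] := h
      rfl
    | cons x b ih =>
      obtain ⟨i, hi, hb⟩ := h
      rw [List.sum_cons, ih hb, ← hi, List.sum_take_add_sum_drop]
  split_ifs with h
  · let b : Composition N := ⟨exponents d, by
      intro x hx
      obtain ⟨v, hv, rfl⟩ := List.mem_map.1 hx
      exact Nat.pos_of_ne_zero (by simpa using hv), by rw [hsum h, c.blocks_sum]⟩
    rw [Finset.sum_eq_single b]
    · simp [b, Composition.length]
    · intro b' _ hb'
      rw [if_neg fun e => hb' (Composition.ext e), smul_zero]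
    · intro hb
      exact absurd (Finset.mem_filter.2 ⟨Finset.mem_univ b, h⟩) hb
  · refine Finset.sum_eq_zero fun b hb => ?_
    rw [if_neg, smul_zero]
    intro e
    exact h (e ▸ (Finset.mem_filter.1 hb).2)

/-- The generating function of the enriched monomial functions in a list of variables. -/
noncomputable def genFn (R : Type*) [CommRing R] (vs : List ℕ+) : List ℕ → MvPowerSeries ℕ+ R :=
  vs.foldr (fun v g => conv (oneVar (MvPowerSeries.X v)) g) unitFn

theorem isMultiplicative_genFn (R : Type*) [CommRing R] (vs : List ℕ+) :
    IsMultiplicative (genFn R vs) := by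
  induction vs with
  | nil => exact isMultiplicative_unitFn
  | cons v vs ih => exact (isMultiplicative_oneVar _).conv ih

theorem oneVar_X (R : Type*) [CommRing R] (v : ℕ+) (w : List ℕ) :
    oneVar (MvPowerSeries.X v : MvPowerSeries ℕ+ R) w =
      MvPowerSeries.monomial (Finsupp.single v w.sum) (if w = [] then 1 else 2) := by
  unfold oneVar
  split_ifs with h
  · subst h
    simp
  · rw [MvPowerSeries.X_pow_eq, ← one_add_one_eq_two, ← one_add_one_eq_two, map_add, add_mul,
      one_mul]

-- Induction on the variables: the exponent of the first one must be the sum of the piece of `w`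
-- assigned to it. As the letters are positive, this determines the cut; exponent `0` forces an
-- empty piece with factor `1`, and a positive exponent a nonempty piece with factor `2`.
open Classical in
theorem coeff_genFn (R : Type*) [CommRing R] {vs : List ℕ+} (hvs : vs.Nodup) {w : List ℕ}
    (hw : ∀ x ∈ w, 0 < x) (d : ℕ+ →₀ ℕ) :
    MvPowerSeries.coeff d (genFn R vs w) =
      if (∀ v, d v ≠ 0 → v ∈ vs) ∧ IsCoarser ((vs.map d).filter (· ≠ 0)) w then
        2 ^ ((vs.map d).filter (· ≠ 0)).length else 0 := by
  induction vs generalizing w d with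
  | nil =>
    have : (∀ v, d v ≠ 0 → v ∈ ([] : List ℕ+)) ↔ d = 0 := by
      simp [Finsupp.ext_iff]
    rw [this]
    simp only [genFn, List.foldr_nil, unitFn, List.map_nil, List.filter_nil, IsCoarser]
    by_cases hd : d = 0 <;> by_cases hw : w = [] <;> simp [hd, hw, MvPowerSeries.coeff_one]
  | cons v vs ih =>
    rw [List.nodup_cons] at hvs
    have hstep : ∀ i, MvPowerSeries.coeff d (oneVar (MvPowerSeries.X v) (w.take i) *
        genFn R vs (w.drop i)) =
        if d v = (w.take i).sum ∧ (∀ u, d u ≠ 0 → u ∈ v :: vs) ∧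
            IsCoarser ((vs.map d).filter (· ≠ 0)) (w.drop i) then
          (if w.take i = [] then 1 else 2) * 2 ^ ((vs.map d).filter (· ≠ 0)).length else 0 := by
      intro i
      set k := (w.take i).sum with hk
      rw [oneVar_X, MvPowerSeries.coeff_monomial_mul, ← hk,
        ih hvs.2 (fun x hx => hw x (List.mem_of_mem_drop hx))]
      have e1 : vs.map (d - Finsupp.single v k : ℕ+ →₀ ℕ) = vs.map d := by
        refine List.map_congr_left fun u hu => ?_
        have : u ≠ v := fun e => hvs.1 (e ▸ hu)
        simp [Finsupp.single_eq_of_ne this]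
      rw [e1]
      have e2 : (Finsupp.single v k ≤ d ∧ ∀ u, (d - Finsupp.single v k : ℕ+ →₀ ℕ) u ≠ 0 → u ∈ vs) ↔
          d v = k ∧ ∀ u, d u ≠ 0 → u ∈ v :: vs := by
        rw [Finsupp.single_le_iff]
        constructor
        · rintro ⟨h1, h2⟩
          refine ⟨?_, fun u hu => ?_⟩
          · by_contra hne
            exact hvs.1 (h2 v (by simp; omega))
          · by_cases huv : u = v
            · simp [huv]
            · exact List.mem_cons_of_mem _ (h2 u (by simpa [Finsupp.single_eq_of_ne huv] using hu))
        · rintro ⟨h1, h2⟩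
          refine ⟨h1.ge, fun u hu => ?_⟩
          by_cases huv : u = v
          · subst huv
            simp [h1] at hu
          · have := h2 u (by simpa [Finsupp.single_eq_of_ne huv] using hu)
            simpa [huv] using this
      rw [mul_ite, mul_zero, ← ite_and]
      exact if_congr (by rw [← and_assoc, e2, and_assoc]) rfl rfl
    have hg : genFn R (v :: vs) w = ∑ i ∈ Finset.range (w.length + 1),
      oneVar (MvPowerSeries.X v) (w.take i) * genFn R vs (w.drop i) := rfl
    rw [hg, map_sum, Finset.sum_congr rfl fun i _ => hstep i]
    by_cases hd : ∀ u, d u ≠ 0 → u ∈ v :: vs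
    swap
    · rw [if_neg fun h => hd h.1]
      exact Finset.sum_eq_zero fun i _ => if_neg fun h => hd h.2.1
    have hinj : ∀ i j, i < j → j ≤ w.length → (w.take j).sum ≠ (w.take i).sum := by
      intro i j hij hj h
      obtain ⟨k, rfl⟩ := Nat.exists_eq_add_of_le hij.le
      rw [List.take_add, List.sum_append, Nat.add_eq_left, List.sum_eq_zero_iff] at h
      have hl : 0 < ((w.drop i).take k).length := by
        rw [List.length_take, List.length_drop]
        omega
      obtain ⟨x, hx⟩ := List.exists_mem_of_length_pos hl
      have := hw x (List.mem_of_mem_drop (List.mem_of_mem_take hx))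
      have := h x hx
      omega
    have hinj' : ∀ i j, i ≤ w.length → j ≤ w.length → (w.take j).sum = (w.take i).sum →
        i = j := by
      intro i j hi hj h
      rcases lt_trichotomy i j with h' | h' | h'
      · exact absurd h (hinj i j h' hj)
      · exact h'
      · exact absurd h.symm (hinj j i h' hi)
    rcases Nat.eq_zero_or_pos (d v) with h0 | h0
    · rw [Finset.sum_eq_single 0]
      · rw [List.map_cons, List.filter_cons_of_neg (by simpa using h0)]
        simp only [List.take_zero, List.sum_nil, h0, true_and, List.drop_zero, if_true, one_mul]
      · intro i hi hi0
        refine if_neg fun h => hi0 ?_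
        rw [h0] at h
        exact hinj' i 0 (Nat.lt_succ_iff.1 (Finset.mem_range.1 hi)) (Nat.zero_le _)
          (by simpa using h.1)
      · simp
    · rw [List.map_cons, List.filter_cons_of_pos (by simpa using h0.ne')]
      by_cases hex : ∃ i, (w.take i).sum = d v ∧ IsCoarser ((vs.map d).filter (· ≠ 0)) (w.drop i)
      -- `IsCoarser` allows a cut index beyond the end of `w`; it is lowered to `w.length` to lie in
      -- the range of summation.
      · obtain ⟨i, hi, hc, hil⟩ : ∃ i, (w.take i).sum = d v ∧
            IsCoarser ((vs.map d).filter (· ≠ 0)) (w.drop i) ∧ i ≤ w.length := by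
          obtain ⟨i, hi, hc⟩ := hex
          rcases le_total i w.length with hl | hl
          · exact ⟨i, hi, hc, hl⟩
          · refine ⟨w.length, ?_, ?_, le_rfl⟩
            · rwa [List.take_length, ← List.take_of_length_le hl]
            · rwa [List.drop_length, ← List.drop_eq_nil_of_le hl]
        have hnil : w.take i ≠ [] := by
          intro h
          rw [h, List.sum_nil] at hi
          omega
        rw [if_pos ⟨hd, i, hi, hc⟩, Finset.sum_eq_single i, if_pos ⟨hi.symm, hd, hc⟩, if_neg hnil,
          List.length_cons, pow_succ']
        · intro j hj hji
          refine if_neg fun h => hji ?_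
          exact hinj' j i (Nat.lt_succ_iff.1 (Finset.mem_range.1 hj)) hil (hi.trans h.1)
        · intro h
          exact absurd (Finset.mem_range.2 (Nat.lt_succ_of_le hil)) h
      · rw [if_neg fun h => hex h.2]
        exact Finset.sum_eq_zero fun i _ => if_neg fun h => hex ⟨i, h.1.symm, h.2.2⟩

/-- The variables come from a larger `d'` so that one `genFn` serves all the exponents `d ≤ d'` that
occur in a coefficient of a product. -/
theorem coeff_eta_eq_coeff_genFn (R : Type*) [CommRing R] {N : ℕ} (c : Composition N)
    {d d' : ℕ+ →₀ ℕ} (h : d ≤ d') :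
    MvPowerSeries.coeff d (eta R c) =
      MvPowerSeries.coeff d (genFn R (d'.support.sort (· ≤ ·)) c.blocks) := by
  classical
  rw [coeff_eta, coeff_genFn R (Finset.sort_nodup _ _) fun _ => c.blocks_pos]
  have hsupp : ∀ v, d v ≠ 0 → v ∈ d'.support.sort (· ≤ ·) := by
    intro v hv
    have := h v
    rw [Finset.mem_sort, Finsupp.mem_support_iff]
    omega
  have he : ((d'.support.sort (· ≤ ·)).map d).filter (· ≠ 0) = exponents d := by
    rw [List.filter_map, exponents]
    congr 1
    refine List.SortedLT.eq_of_mem_iff ?_ (Finset.sortedLT_sort _) fun v => ?_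
    · exact ((Finset.sortedLT_sort _).pairwise.filter _).sortedLT
    · simp only [List.mem_filter, Function.comp_apply, decide_eq_true_eq]
      rw [Finset.mem_sort, Finset.mem_sort, Finsupp.mem_support_iff, Finsupp.mem_support_iff]
      exact ⟨fun h => h.2, fun h => ⟨by simpa using hsupp v h, h⟩⟩
  rw [he]
  exact if_congr ⟨fun h => ⟨hsupp, h⟩, fun h => h.2⟩ rfl rfl

end Coefficients

/-! ### Shuffles as bijections and as marked words -/

section Shuffles

theorem inl_cons_mem_shuffles {α β : Type*} {a : List α} {b : List β} {x : α}
    {w : List (α ⊕ β)} :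
    Sum.inl x :: w ∈ shuffles a b ↔ ∃ a', x :: a' = a ∧ w ∈ shuffles a' b := by
  rcases a with _ | ⟨y, _ | ⟨z, a⟩⟩ <;> rcases b with _ | ⟨t, b⟩ <;>
    grind [shuffles]

theorem inr_cons_mem_shuffles {α β : Type*} {a : List α} {b : List β} {x : β}
    {w : List (α ⊕ β)} :
    Sum.inr x :: w ∈ shuffles a b ↔ ∃ b', x :: b' = b ∧ w ∈ shuffles a b' := by
  rcases a with _ | ⟨y, a⟩ <;> rcases b with _ | ⟨z, b⟩ <;>
    grind [shuffles]

/-- The bridge between the recursive list of shuffles and order-preserving bijections: a shuffle is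
recognised by its two subwords. -/
theorem mem_shuffles {α β : Type*} {a : List α} {b : List β} {w : List (α ⊕ β)} :
    w ∈ shuffles a b ↔ w.filterMap Sum.getLeft? = a ∧ w.filterMap Sum.getRight? = b := by
  induction w generalizing a b with
  | nil => rcases a with _ | ⟨x, a⟩ <;> rcases b with _ | ⟨y, b⟩ <;> simp [shuffles]
  | cons u w ih =>
    rcases u with u | u
    · rw [inl_cons_mem_shuffles]
      simp only [ih, List.filterMap_cons, Sum.getLeft?_inl, Sum.getRight?_inl]
      grind
    · rw [inr_cons_mem_shuffles]
      simp only [ih, List.filterMap_cons, Sum.getLeft?_inr, Sum.getRight?_inr]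
      grind

theorem nodup_shuffles {α β : Type*} (a : List α) (b : List β) : (shuffles a b).Nodup := by
  fun_induction shuffles a b with
  | case1 b => simp
  | case2 x a => simp
  | case3 x a y b ih1 ih2 =>
    refine List.nodup_append.2 ⟨ih1.map (List.cons_injective), ih2.map (List.cons_injective), ?_⟩
    intro u hu v hv
    simp only [List.mem_map] at hu hv
    obtain ⟨u, -, rfl⟩ := hu
    obtain ⟨v, -, rfl⟩ := hv
    simp

/-- The shuffled word of the positions in the two sequences. -/
def Shuffle.word {n m : ℕ} (s : Shuffle n m) : List (Fin n ⊕ Fin m) :=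
  List.ofFn s.1.symm

theorem Shuffle.word_injective (n m : ℕ) :
    Function.Injective (Shuffle.word : Shuffle n m → List (Fin n ⊕ Fin m)) := by
  intro s t h
  have h1 := List.ofFn_injective h
  exact Subtype.ext (Equiv.symm_bijective.injective (DFunLike.coe_injective h1))

theorem filterMap_ofFn_eq_finRange {n k : ℕ} {γ : Type*} (e : γ ≃ Fin k) (f : γ → Option (Fin n))
    (g : Fin n → γ) (hg : StrictMono fun i => e (g i)) (hf : ∀ c i, f c = some i ↔ c = g i) :
    (List.ofFn e.symm).filterMap f = List.finRange n := by
  refine List.SortedLT.eq_of_mem_iff ?_ (List.sortedLT_finRange n) ?_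
  · apply List.Pairwise.sortedLT
    rw [List.pairwise_filterMap, List.pairwise_ofFn]
    intro i j hij b hb b' hb'
    rw [hf] at hb hb'
    rw [← hg.lt_iff_lt]
    simpa [← hb, ← hb'] using hij
  · intro i
    simp only [List.mem_filterMap, List.mem_finRange, iff_true]
    exact ⟨g i, List.mem_ofFn.2 ⟨e (g i), e.symm_apply_apply _⟩, (hf _ _).2 rfl⟩

theorem Shuffle.word_mem_shuffles {n m : ℕ} (s : Shuffle n m) :
    s.word ∈ shuffles (List.finRange n) (List.finRange m) := by
  refine mem_shuffles.2 ⟨?_, ?_⟩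
  · refine filterMap_ofFn_eq_finRange s.1 _ Sum.inl s.2.1 ?_
    rintro (c | c) i <;> simp
  · refine filterMap_ofFn_eq_finRange s.1 _ Sum.inr s.2.2 ?_
    rintro (c | c) i <;> simp

theorem getElem_lt_of_filterMap_eq_finRange {n : ℕ} {γ : Type*} {w : List γ} {f : γ → Option (Fin n)}
    (h : w.filterMap f = List.finRange n) {i j : ℕ} (hi : i < w.length) (hj : j < w.length)
    {p q : Fin n} (hp : f w[i] = some p) (hq : f w[j] = some q) (hpq : p < q) : i < j := by
  have hs : (w.filterMap f).Pairwise (· < ·) := by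
    rw [h]
    exact (List.sortedLT_finRange n).pairwise
  rw [List.pairwise_filterMap, List.pairwise_iff_getElem] at hs
  rcases lt_trichotomy i j with h' | h' | h'
  · exact h'
  · subst h'
    rw [hp, Option.some_inj] at hq
    exact absurd hpq (by simp [hq])
  · exact absurd hpq (hs j i hj hi h' q hq p hp).not_gt

/-- The word has `n + m` letters and contains every position, so reading off its letters is a
surjection between finite sets of equal size, hence a bijection. -/
theorem Shuffle.exists_word_eq {n m : ℕ} {w : List (Fin n ⊕ Fin m)}
    (hw : w ∈ shuffles (List.finRange n) (List.finRange m)) : ∃ s : Shuffle n m, s.word = w := by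
  obtain ⟨hl, hr⟩ := mem_shuffles.1 hw
  have hlen : w.length = n + m := by
    have h1 : ∀ w : List (Fin n ⊕ Fin m), w.length =
        (w.filterMap Sum.getLeft?).length + (w.filterMap Sum.getRight?).length := by
      intro w
      induction w with
      | nil => rfl
      | cons x w ih => rcases x with x | x <;> simp [ih, List.filterMap_cons] <;> omega
    rw [h1, hl, hr, List.length_finRange, List.length_finRange]
  have hmem : ∀ c, c ∈ w := by
    rintro (c | c)
    · have : c ∈ w.filterMap Sum.getLeft? := by rw [hl]; exact List.mem_finRange c
      obtain ⟨x | x, hx, hc⟩ := List.mem_filterMap.1 this <;> simp_all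
    · have : c ∈ w.filterMap Sum.getRight? := by rw [hr]; exact List.mem_finRange c
      obtain ⟨x | x, hx, hc⟩ := List.mem_filterMap.1 this <;> simp_all
  let g : Fin (n + m) → Fin n ⊕ Fin m := fun k => w[k]
  have hsurj : Function.Surjective g := by
    intro c
    obtain ⟨i, hi, h⟩ := List.getElem_of_mem (hmem c)
    exact ⟨⟨i, hlen ▸ hi⟩, h⟩
  have hbij : Function.Bijective g :=
    (Fintype.bijective_iff_surjective_and_card g).2 ⟨hsurj, by simp⟩
  let e := Equiv.ofBijective g hbij
  have he : ∀ c, w[(e.symm c : ℕ)]'(by rw [hlen]; exact (e.symm c).2) = c := fun c =>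
    e.apply_symm_apply c
  refine ⟨⟨e.symm, ?_, ?_⟩, ?_⟩
  · intro p q hpq
    exact getElem_lt_of_filterMap_eq_finRange hl _ _ (by rw [he]; rfl) (by rw [he]; rfl) hpq
  · intro p q hpq
    exact getElem_lt_of_filterMap_eq_finRange hr _ _ (by rw [he]; rfl) (by rw [he]; rfl) hpq
  · refine List.ext_getElem (by simp [Shuffle.word, hlen]) fun i h1 h2 => ?_
    simp [Shuffle.word, e, g]

theorem sum_shuffle {S : Type*} [CommRing S] {n m : ℕ} (F : List (Fin n ⊕ Fin m) → S) :
    ∑ s : Shuffle n m, F s.word = shuffleSum F (List.finRange n) (List.finRange m) := by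
  rw [shuffleSum, ← List.sum_toFinset _ (nodup_shuffles _ _)]
  refine Finset.sum_bij (fun s _ => s.word) ?_ ?_ ?_ ?_
  · intro s _
    exact List.mem_toFinset.2 s.word_mem_shuffles
  · intro s _ t _ h
    exact Shuffle.word_injective n m h
  · intro w hw
    obtain ⟨s, hs⟩ := Shuffle.exists_word_eq (List.mem_toFinset.1 hw)
    exact ⟨s, Finset.mem_univ s, hs⟩
  · intro s _
    rfl

theorem shuffles_map {α β α' β' : Type*} (f : α → α') (g : β → β') (a : List α) (b : List β) :
    shuffles (a.map f) (b.map g) = (shuffles a b).map (List.map (Sum.map f g)) := by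
  fun_induction shuffles a b with
  | case1 b => simp [shuffles]
  | case2 x a => simp [shuffles]
  | case3 x a y b ih1 ih2 =>
    simp only [List.map_cons] at ih1 ih2
    simp [shuffles, ih1, ih2, Function.comp_def]

/-- Positions are shuffled first and replaced by parts afterwards, so equal parts cause no loss of
multiplicity. -/
theorem sum_shuffle_blocks {S : Type*} [CommRing S] {A B : ℕ} (a : Composition A)
    (b : Composition B) (F : List (ℕ ⊕ ℕ) → S) :
    ∑ s : Shuffle a.length b.length, F (s.word.map (Sum.map a.blocksFun b.blocksFun)) =
      shuffleSum F a.blocks b.blocks := by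
  rw [sum_shuffle fun w => F (w.map (Sum.map a.blocksFun b.blocksFun)),
    ← a.ofFn_blocksFun, ← b.ofFn_blocksFun, List.ofFn_eq_map, List.ofFn_eq_map, shuffleSum,
    shuffleSum, shuffles_map, List.map_map]
  rfl

end Shuffles

/-! ### Sets of merge positions and signed sums over merges -/

section Merging

/-- The list version of `mergeAt`. -/
def mergeList (l : List ℕ) (i : ℕ) : List ℕ :=
  if h : 2 ≤ i ∧ i < l.length then
    l.take (i - 2) ++ (l[i - 2] + l[i - 1] + l[i]) :: l.drop (i + 1)
  else l

theorem blocks_mergeAt {N : ℕ} (c : Composition N) (i : ℕ) :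
    (mergeAt c i).blocks = mergeList c.blocks i := by
  unfold mergeAt mergeList
  by_cases h : 2 ≤ i ∧ i < c.length
  · rw [dif_pos h, dif_pos h]
  · rw [dif_neg h, dif_neg h]

theorem mergeList_cons (x : ℕ) (l : List ℕ) {i : ℕ} (hi : 2 ≤ i) :
    mergeList (x :: l) (i + 1) = x :: mergeList l i := by
  obtain ⟨k, rfl⟩ := Nat.exists_eq_add_of_le' hi
  unfold mergeList
  by_cases h : k + 2 < l.length
  · rw [dif_pos ⟨by omega, by simpa using h⟩, dif_pos ⟨by omega, h⟩]
    simp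
  · rw [dif_neg (by simpa using h), dif_neg (by simpa using h)]

theorem mergeList_two (x y : ℕ) {l : List ℕ} (hl : l ≠ []) :
    mergeList (x :: y :: l) 2 = addHead (x + y) l := by
  rcases l with _ | ⟨z, l⟩
  · exact absurd rfl hl
  · simp [mergeList, addHead]

theorem mergeList_ne_nil {l : List ℕ} (hl : l ≠ []) (i : ℕ) : mergeList l i ≠ [] := by
  unfold mergeList
  split_ifs <;> simp [hl]

/-- The list version of `mergeSet`. -/
def mergeWord (l : List ℕ) (I : Finset ℕ) : List ℕ :=
  (I.sort (· ≤ ·)).foldr (fun i l => mergeList l i) l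

theorem blocks_mergeSet {N : ℕ} (c : Composition N) (I : Finset ℕ) :
    (mergeSet c I).blocks = mergeWord c.blocks I := by
  unfold mergeSet mergeWord
  induction I.sort (· ≤ ·) with
  | nil => rfl
  | cons i l ih => rw [List.foldr_cons, blocks_mergeAt, ih, List.foldr_cons]

theorem sort_image_add_one (I : Finset ℕ) :
    (I.image (· + 1)).sort (· ≤ ·) = (I.sort (· ≤ ·)).map (· + 1) := by
  refine List.SortedLT.eq_of_mem_iff (Finset.sortedLT_sort _) ?_ (by simp)
  apply List.Pairwise.sortedLT
  rw [List.pairwise_map]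
  exact (Finset.sortedLT_sort I).pairwise.imp fun h => by omega

theorem mergeWord_cons (x : ℕ) (l : List ℕ) {I : Finset ℕ} (hI : ∀ i ∈ I, 2 ≤ i) :
    mergeWord (x :: l) (I.image (· + 1)) = x :: mergeWord l I := by
  unfold mergeWord
  rw [sort_image_add_one, List.foldr_map]
  have h : ∀ i ∈ I.sort (· ≤ ·), 2 ≤ i := by simpa using hI
  generalize I.sort (· ≤ ·) = L at h
  induction L with
  | nil => rfl
  | cons i L ih =>
    rw [List.foldr_cons, ih fun j hj => h j (List.mem_cons_of_mem _ hj),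
      mergeList_cons _ _ (h i (by simp)), List.foldr_cons]

theorem mergeWord_ne_nil {l : List ℕ} (hl : l ≠ []) (I : Finset ℕ) : mergeWord l I ≠ [] := by
  unfold mergeWord
  induction I.sort (· ≤ ·) with
  | nil => exact hl
  | cons i L ih => exact mergeList_ne_nil ih i

/-- Position `2` is the smallest, so its merge comes last, when the rest of the word is already
merged. -/
theorem mergeWord_insert_two (x y : ℕ) {l : List ℕ} (hl : l ≠ []) {I : Finset ℕ}
    (hI : ∀ i ∈ I, 2 ≤ i) :
    mergeWord (x :: y :: l) (insert 2 ((I.image (· + 1)).image (· + 1))) =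
      addHead (x + y) (mergeWord l I) := by
  have h1 : ∀ i ∈ I.image (· + 1), 3 ≤ i := by
    simpa using fun i hi => hI i hi
  have h2 : ∀ i ∈ (I.image (· + 1)).image (· + 1), 4 ≤ i := by
    simpa using fun i hi => hI i hi
  rw [← mergeList_two x y (mergeWord_ne_nil hl I), ← mergeWord_cons y l hI,
    ← mergeWord_cons x _ fun i hi => (by norm_num : 2 ≤ 3).trans (h1 i hi)]
  unfold mergeWord
  rw [Finset.sort_insert _ (fun i hi => (by norm_num : 2 ≤ 4).trans (h2 i hi)), List.foldr_cons]
  intro h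
  have := h2 2 h
  omega

/-- The positions at which letters of a marked word may be merged with their neighbours. -/
def mergeable : List (ℕ ⊕ ℕ) → Finset ℕ
  | [] => ∅
  | _ :: Sum.inr y :: Sum.inl z :: r =>
    insert 2 ((mergeable (Sum.inr y :: Sum.inl z :: r)).image (· + 1))
  | _ :: r => (mergeable r).image (· + 1)

theorem mergeable_cons (x : ℕ ⊕ ℕ) (r : List (ℕ ⊕ ℕ))
    (h : ∀ y z r', r ≠ Sum.inr y :: Sum.inl z :: r') :
    mergeable (x :: r) = (mergeable r).image (· + 1) := by
  rw [mergeable]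
  intro y z r' e
  exact h y z r' e

/-- Mergeable positions are never adjacent: position `3` holds an `inl`. So choosing or rejecting
position `2` leaves the same further choices. -/
theorem mergeable_inr_inl (x : ℕ ⊕ ℕ) (y z : ℕ) (r : List (ℕ ⊕ ℕ)) :
    mergeable (x :: Sum.inr y :: Sum.inl z :: r) =
      insert 2 (((mergeable (Sum.inl z :: r)).image (· + 1)).image (· + 1)) := by
  rw [mergeable, mergeable_cons _ _ (by simp)]

theorem mem_mergeable {u : List (ℕ ⊕ ℕ)} {i : ℕ} :
    i ∈ mergeable u ↔
      2 ≤ i ∧ (∃ y, u[i - 1]? = some (Sum.inr y)) ∧ ∃ z, u[i]? = some (Sum.inl z) := by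
  have hcons : ∀ (x : ℕ ⊕ ℕ) r, (∀ i, i ∈ mergeable r ↔
      2 ≤ i ∧ (∃ y, r[i - 1]? = some (Sum.inr y)) ∧ ∃ z, r[i]? = some (Sum.inl z)) →
      ∀ i, i ∈ (mergeable r).image (· + 1) ↔
        3 ≤ i ∧ (∃ y, (x :: r)[i - 1]? = some (Sum.inr y)) ∧
          ∃ z, (x :: r)[i]? = some (Sum.inl z) := by
    intro x r h i
    simp only [Finset.mem_image, h]
    constructor
    · rintro ⟨j, ⟨hj, h1, h2⟩, rfl⟩
      obtain ⟨j, rfl⟩ := Nat.exists_eq_add_of_le' hj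
      exact ⟨by omega, h1, h2⟩
    · rintro ⟨hj, h1, h2⟩
      obtain ⟨j, rfl⟩ := Nat.exists_eq_add_of_le' hj
      exact ⟨j + 2, ⟨by omega, h1, h2⟩, rfl⟩
  induction u using mergeSum_induction generalizing i with
  | nil => simp [mergeable]
  | inr_inl x y z r h1 h2 =>
    rw [mergeable, Finset.mem_insert, hcons x _ (fun i => h1)]
    constructor
    · rintro (rfl | h)
      · simp
      · exact ⟨by omega, h.2⟩
    · rintro ⟨h, h'⟩
      rcases Nat.lt_or_ge i 3 with h3 | h3
      · exact Or.inl (by omega)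
      · exact Or.inr ⟨h3, h'⟩
  | cons x r h ih =>
    rw [mergeable_cons _ _ h, hcons x _ (fun i => ih)]
    refine ⟨fun h => ⟨by omega, h.2⟩, fun h' => ⟨?_, h'.2⟩⟩
    by_contra h3
    obtain rfl : i = 2 := by omega
    obtain ⟨-, ⟨y, hy⟩, z, hz⟩ := h'
    rcases r with _ | ⟨a, _ | ⟨b, r⟩⟩
    · simp at hy
    · simp at hz
    · simp at hy hz
      exact h y z r (by rw [hy, hz])

/-- The sum over the sets of mergeable positions is the signed sum over all merges. -/
theorem sum_powerset_mergeable {S : Type*} [CommRing S] (f : List ℕ → S) (u : List (ℕ ⊕ ℕ)) :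
    ∑ I ∈ (mergeable u).powerset, (-1) ^ I.card * f (mergeWord (u.map (Sum.elim id id)) I) =
      mergeSum f u := by
  have hinj : Function.Injective fun i : ℕ => i + 1 := fun i j h => by simpa using h
  have himg : ∀ (T : Finset ℕ) (g : Finset ℕ → S),
      ∑ I ∈ (T.image (· + 1)).powerset, g I = ∑ I ∈ T.powerset, g (I.image (· + 1)) := by
    intro T g
    rw [Finset.powerset_image, Finset.sum_image (Finset.image_injective hinj).injOn]
  have htwo : ∀ {v : List (ℕ ⊕ ℕ)} {I : Finset ℕ}, I ∈ (mergeable v).powerset →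
      ∀ i ∈ I, 2 ≤ i := by
    intro v I hI i hi
    exact (mem_mergeable.1 (Finset.mem_powerset.1 hI hi)).1
  induction u using mergeSum_induction generalizing f with
  | nil => simp [mergeable, mergeSum, mergeWord]
  | inr_inl x y z r h1 h2 =>
    rw [mergeSum_inr_inl, ← h1, ← h2, mergeable_inr_inl, Finset.sum_powerset_insert,
      mergeable_cons (Sum.inr y) _ (by simp), himg, himg, himg, himg, himg, sub_eq_add_neg,
      ← Finset.sum_neg_distrib]
    · congr 1
      · refine Finset.sum_congr rfl fun I hI => ?_
        have h3 : ∀ i ∈ I.image (· + 1), 2 ≤ i := by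
          simpa using fun i hi => (htwo hI i hi).trans (Nat.le_succ i)
        rw [Finset.card_image_of_injective _ hinj, List.map_cons, mergeWord_cons _ _ h3]
      · refine Finset.sum_congr rfl fun I hI => ?_
        have h3 : 2 ∉ (I.image (· + 1)).image (· + 1) := by
          simp only [Finset.mem_image, not_exists, not_and]
          rintro _ ⟨i, hi, rfl⟩
          have := htwo hI i hi
          omega
        rw [Finset.card_insert_of_notMem h3, Finset.card_image_of_injective _ hinj,
          Finset.card_image_of_injective _ hinj, List.map_cons, List.map_cons,
          mergeWord_insert_two _ _ (by simp) (htwo hI), pow_succ]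
        simp
    · simp only [Finset.mem_image, not_exists, not_and]
      rintro _ ⟨i, hi, rfl⟩
      have := (mem_mergeable.1 hi).1
      omega
  | cons x r h ih =>
    rw [mergeSum_cons _ _ _ h, ← ih, mergeable_cons _ _ h, himg]
    refine Finset.sum_congr rfl fun I hI => ?_
    rw [Finset.card_image_of_injective _ hinj, List.map_cons, mergeWord_cons _ _ (htwo hI)]

theorem blocks_comp {A B : ℕ} {a : Composition A} {b : Composition B}
    (s : Shuffle a.length b.length) :
    s.comp.blocks = (s.word.map (Sum.map a.blocksFun b.blocksFun)).map (Sum.elim id id) := by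
  rw [Shuffle.word, List.map_ofFn, List.map_ofFn]
  change List.ofFn _ = _
  congr 1
  funext k
  simp only [Function.comp_apply]
  rcases s.1.symm k with i | i <;> rfl

/-- Position `i` corresponds to list index `i - 1`. Positions start at `1`, so the truncated
subtraction is exact. -/
theorem mergeable_word {A B : ℕ} (a : Composition A) (b : Composition B)
    (s : Shuffle a.length b.length) :
    mergeable (s.word.map (Sum.map a.blocksFun b.blocksFun)) =
      (s.posSnd \ s.posSnd.image (fun i => i - 1)) \ {1, a.length + b.length} := by
  have hget : ∀ k (hk : k < a.length + b.length),
      (s.word.map (Sum.map a.blocksFun b.blocksFun))[k]? =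
        some (Sum.map a.blocksFun b.blocksFun (s.1.symm ⟨k, hk⟩)) := by
    intro k hk
    simp [Shuffle.word, hk]
  have hlen : (s.word.map (Sum.map a.blocksFun b.blocksFun)).length = a.length + b.length := by
    simp [Shuffle.word]
  ext i
  simp only [mem_mergeable, Finset.mem_sdiff, Finset.mem_insert, Finset.mem_singleton,
    Shuffle.posSnd, Finset.mem_image, Finset.mem_univ, true_and, not_or, not_exists]
  constructor
  · rintro ⟨h2, ⟨y, hy⟩, z, hz⟩
    have hi : i < a.length + b.length := by
      rw [← hlen]
      exact (List.getElem?_eq_some_iff.1 hz).1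
    rw [hget _ (by omega), Option.some_inj] at hy
    rw [hget _ hi, Option.some_inj] at hz
    refine ⟨⟨?_, ?_⟩, by omega, by omega⟩
    · rcases h : s.1.symm ⟨i - 1, by omega⟩ with j | j
      · simp [h] at hy
      · refine ⟨j, ?_⟩
        rw [← h, Equiv.apply_symm_apply]
        simp only
        omega
    · rintro _ ⟨⟨j, rfl⟩, hj⟩
      have : (⟨i, hi⟩ : Fin (a.length + b.length)) = s.1 (Sum.inr j) :=
        Fin.ext (by simpa using hj.symm)
      simp [this] at hz
  · rintro ⟨⟨⟨j, rfl⟩, h⟩, h1, h2⟩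
    have hj := (s.1 (Sum.inr j)).2
    have hi : (s.1 (Sum.inr j) : ℕ) + 1 < a.length + b.length := by omega
    refine ⟨by omega, ⟨b.blocksFun j, ?_⟩, ?_⟩
    · rw [Nat.add_sub_cancel, hget _ hj]
      simp
    · rcases h' : s.1.symm ⟨_, hi⟩ with k | k
      · exact ⟨a.blocksFun k, by rw [hget _ hi, h']; rfl⟩
      · refine absurd ⟨⟨k, rfl⟩, ?_⟩ (h ((s.1 (Sum.inr k) : ℕ) + 1))
        rw [← h', Equiv.apply_symm_apply, Nat.add_sub_cancel]

end Merging

/-! ### The product rule -/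

section ProductRule

theorem coeff_neg_one_pow_mul {R : Type*} [CommRing R] (k : ℕ) {φ ψ : MvPowerSeries ℕ+ R}
    {d : ℕ+ →₀ ℕ} (h : MvPowerSeries.coeff d φ = MvPowerSeries.coeff d ψ) :
    MvPowerSeries.coeff d ((-1) ^ k * φ) = MvPowerSeries.coeff d ((-1) ^ k * ψ) := by
  rcases neg_one_pow_eq_or (MvPowerSeries ℕ+ R) k with e | e <;> simp [e, h]

end ProductRule

end EnrichedMonomial

theorem mainTheorem1 (R : Type*) [CommRing R] {A B : ℕ} (α : Composition A) (β : Composition B) :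
    EnrichedMonomial.eta R α * EnrichedMonomial.eta R β =
      ∑ s : EnrichedMonomial.Shuffle α.length β.length,
        ∑ I ∈ ((s.posSnd \ s.posSnd.image (fun i => i - 1)) \ {1, α.length + β.length}).powerset,
          (-1) ^ I.card * EnrichedMonomial.eta R (EnrichedMonomial.mergeSet s.comp I) := by
  ext d
  -- Both factors of a monomial of exponent `d` involve only the variables of `d`, so these finitely
  -- many suffice.
  set vs := d.support.sort (· ≤ ·)
  have hleft : MvPowerSeries.coeff d (EnrichedMonomial.eta R α * EnrichedMonomial.eta R β) =
      MvPowerSeries.coeff d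
        (EnrichedMonomial.genFn R vs α.blocks * EnrichedMonomial.genFn R vs β.blocks) := by
    rw [MvPowerSeries.coeff_mul, MvPowerSeries.coeff_mul]
    refine Finset.sum_congr rfl fun p hp => ?_
    rw [EnrichedMonomial.coeff_eta_eq_coeff_genFn R α
        (Finset.HasAntidiagonal.mem_antidiagonal.1 hp ▸ le_self_add),
      EnrichedMonomial.coeff_eta_eq_coeff_genFn R β
        (Finset.HasAntidiagonal.mem_antidiagonal.1 hp ▸ le_add_self)]
  rw [hleft, EnrichedMonomial.isMultiplicative_genFn, ← EnrichedMonomial.sum_shuffle_blocks α β,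
    map_sum, map_sum]
  refine Finset.sum_congr rfl fun s _ => ?_
  rw [← EnrichedMonomial.sum_powerset_mergeable, EnrichedMonomial.mergeable_word, map_sum, map_sum]
  refine Finset.sum_congr rfl fun I _ => EnrichedMonomial.coeff_neg_one_pow_mul _ ?_
  rw [EnrichedMonomial.coeff_eta_eq_coeff_genFn R _ le_rfl, EnrichedMonomial.blocks_mergeSet,
    EnrichedMonomial.blocks_comp]
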